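/- For a measurable space $X$ let $\mathbb S(X)$ be the set of subprobability measures on $X$ with the $\sigma$-algebra $w(X)$ generated by the evaluations $\mu\mapsto\mu(A)$, $A$ measurable; for measurable $h\colon X\to Y$ let $\mathbb S h\colon\mathbb S(X)\to\mathbb S(Y)$, $(\mathbb S h)(\mu)(B)=\mu(h^{-1}[B])$. A stochastic effectivity function $P\colon X\twoheadrightarrow Y$ assigns to each $x\in X$ a family $P(x)\subseteq w(Y)$ that is upper closed in $w(Y)$, such that $\{(x,q)\mid H_q\in P(x)\}$ is measurable in $X\times[0,1]$ for every measurable $H\subseteq\mathbb S(Y)\times[0,1]$, where $H_q=\{\mu\mid(\mu,q)\in H\}$. A morphism $(h,k)\colon P\to P'$, where $P'\colon X'\twoheadrightarrow Y'$, is a pair of measurable maps $h\colon X\to X'$, $k\colon Y\to Y'$ with $G\in P'(h(x))\iff(\mathbb S k)^{-1}[G]\in P(x)$ for all $x\in X$, $G\in w(Y')$; write $h$ for $(h,h)$. Call $P\colon X\twoheadrightarrow X$ finitely supported if for every $x$ there is a finite set $\kappa(x)\in w(X)$ with $P(x)=\{A\in w(X)\mid\kappa(x)\subseteq A\}$. For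 a sub-$\sigma$-algebra $\mathcal C$ of the $\sigma$-algebra of $X$ let $i_{\mathcal C}\colon X\to(X,\mathcal C)$ be the identity; $\mathcal C$ defines a subsystem of $P\colon X\twoheadrightarrow X$ if there is an effectivity function $P_{\mathcal C}\colon(X,\mathcal C)\twoheadrightarrow(X,\mathcal C)$ such that $i_{\mathcal C}$ is a morphism $P\to P_{\mathcal C}$. Two effectivity functions are bisimilar if there are morphisms to both of them from a common third one. **Proposition.** Let $S,T,U$ be standard Borel spaces, let $P\colon S\twoheadrightarrow S$ and $Q\colon T\twoheadrightarrow T$ be finitely supported stochastic effectivity functions, and suppose that they are behaviorally equivalent with mediator $M\colon U\twoheadrightarrow U$, i.e. that there are surjective morphisms $f\colon P\to M$ and $g\colon Q\to M$. Let $\mathcal C_P$ be the $\sigma$-algebra of measurable sets $A\subseteq S$ with $f(a)=f(b),\ a\in A\Rightarrow b\in A$, let $\mathcal C_Q$ be the analogous $\sigma$-algebra for $g$ on $T$, and let $W=\{(s,t)\in S\times T\mid f(s)=g(t)\}$ with the trace $\mathcal W$ of $\mathcal C_P\otimes\mathcal C_Q$. Then $\mathcal C_P$ and $\mathcal C_Q$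 define subsystems of $P$ and $Q$, with effectivity functions $P_{\mathcal C}$ on $(S,\mathcal C_P)$ and $Q_{\mathcal C}$ on $(T,\mathcal C_Q)$, and there is an effectivity function $\tau\colon(W,\mathcal W)\twoheadrightarrow(W,\mathcal W)$ such that the projections are morphisms $P_{\mathcal C}\xleftarrow{\ \pi_S\ }\tau\xrightarrow{\ \pi_T\ }Q_{\mathcal C}$. Moreover, let $P_s\colon S\twoheadrightarrow(S,\mathcal C_P)$, $Q_s\colon T\twoheadrightarrow(T,\mathcal C_Q)$ and $\tau_s\colon W\twoheadrightarrow(W,\mathcal W)$ be $P_{\mathcal C}$, $Q_{\mathcal C}$ and $\tau$ with the domains $S$, $T$, $W$ carrying their full Borel $\sigma$-algebras (on $W$, the trace of that of $S\times T$). Then $(\pi_S,\pi_S)$ and $(\pi_T,\pi_T)$ are morphisms $P_s\leftarrow\tau_s\to Q_s$; in particular $P_s$ and $Q_s$ are bisimilar. -/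

import Mathlib

open MeasureTheory Set

namespace Effectivity

universe u v w x

/-! ### Subprobability measures and the weak-* sigma-algebra -/

/-- The set of all subprobability measures on a measurable space. -/
def SubProb (S : Type u) [MeasurableSpace S] : Type u := {μ : Measure S // μ univ ≤ 1}

/-- The sigma-algebra `w(S)` on `SubProb S`: the trace of the sigma-algebra on `Measure S` that is
generated by the evaluations `μ ↦ μ A` at measurable sets `A`. -/
instance SubProb.instMeasurableSpace (S : Type u) [MeasurableSpace S] :
    MeasurableSpace (SubProb S) :=
  inferInstanceAs (MeasurableSpace {μ : Measure S // μ univ ≤ 1})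

/-- The image of a subprobability under a map, `B ↦ μ (f ⁻¹' B)`; only used for measurable `f`. -/
noncomputable def SubProb.map {S : Type u} {T : Type v} [MeasurableSpace S] [MeasurableSpace T]
    (f : S → T) (μ : SubProb S) : SubProb T :=
  ⟨μ.1.map f, by
    by_cases hf : AEMeasurable f μ.1
    · rw [Measure.map_apply_of_aemeasurable hf MeasurableSet.univ]
      exact μ.2
    · rw [Measure.map_of_not_aemeasurable hf]
      simp⟩

/-! ### Stochastic effectivity functions -/

/-- A stochastic effectivity function from `S` to `T`: to every `s` it assigns a family
`portfolio s` of measurable sets of subprobabilities on `T` which is upper closed among the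
measurable sets, such that the resulting map is t-measurable. -/
structure EffFn (S : Type u) (T : Type v) [MeasurableSpace S] [MeasurableSpace T] where
  portfolio : S → Set (Set (SubProb T))
  measurableSet_of_mem : ∀ s, ∀ A ∈ portfolio s, MeasurableSet A
  upper_closed : ∀ s, ∀ A ∈ portfolio s, ∀ B, MeasurableSet B → A ⊆ B → B ∈ portfolio s
  t_measurable : ∀ H : Set (SubProb T × unitInterval), MeasurableSet H →
    MeasurableSet {p : S × unitInterval | {μ : SubProb T | (μ, p.2) ∈ H} ∈ portfolio p.1}

/-- The filter of measurable sets of subprobabilities generated by `V`. -/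
def filterGenerated {S : Type u} [MeasurableSpace S] (V : Set (SubProb S)) :
    Set (Set (SubProb S)) :=
  {A | MeasurableSet A ∧ V ⊆ A}

/-- `P` is finitely supported: each `P(s)` is the filter generated by a finite (measurable) set
`κ(s)` of subprobabilities. -/
def EffFn.FinitelySupported {S : Type u} [MeasurableSpace S] (P : EffFn S S) : Prop :=
  ∃ κ : S → Set (SubProb S),
    (∀ s, (κ s).Finite) ∧ (∀ s, MeasurableSet (κ s)) ∧
      ∀ s, P.portfolio s = filterGenerated (κ s)

/-- `(f, g)` is a morphism `P → Q` for `P` from `S` to `T` and `Q` from `M` to `N`. -/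
structure IsMorphism {S : Type u} {T : Type v} {M : Type w} {N : Type x}
    [MeasurableSpace S] [MeasurableSpace T] [MeasurableSpace M] [MeasurableSpace N]
    (P : EffFn S T) (Q : EffFn M N) (f : S → M) (g : T → N) : Prop where
  measurable_left : Measurable f
  measurable_right : Measurable g
  comm : ∀ s, Q.portfolio (f s) = {G | MeasurableSet G ∧ SubProb.map g ⁻¹' G ∈ P.portfolio s}

/-- `M` with the surjective morphisms `(f, g) : P → M` and `(j, l) : Q → M` witnesses that
`P` and `Q` are behaviorally equivalent (a cospan of surjective morphisms). -/
structure MediatesBehavioralEquivalence {S T X Y A B : Type*}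
    [MeasurableSpace S] [MeasurableSpace T] [MeasurableSpace X] [MeasurableSpace Y]
    [MeasurableSpace A] [MeasurableSpace B]
    (P : EffFn S T) (Q : EffFn X Y) (M : EffFn A B)
    (f : S → A) (g : T → B) (j : X → A) (l : Y → B) : Prop where
  left : IsMorphism P M f g
  right : IsMorphism Q M j l
  left_surjective : Function.Surjective f ∧ Function.Surjective g
  right_surjective : Function.Surjective j ∧ Function.Surjective l

/-- `M` with the morphisms `(f, g) : M → P` and `(j, l) : M → Q` witnesses that
`P` and `Q` are bisimilar (a span of morphisms). -/
structure MediatesBisimilarity {S T X Y A B : Type*}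
    [MeasurableSpace S] [MeasurableSpace T] [MeasurableSpace X] [MeasurableSpace Y]
    [MeasurableSpace A] [MeasurableSpace B]
    (P : EffFn S T) (Q : EffFn X Y) (M : EffFn A B)
    (f : A → S) (g : B → T) (j : A → X) (l : B → Y) : Prop where
  left : IsMorphism M P f g
  right : IsMorphism M Q j l

/-! ### Passing to a sub-sigma-algebra -/

/-- The space `X_C`: the set `X` with `C` as its sigma-algebra. -/
def WithSigma {X : Type u} (_C : MeasurableSpace X) : Type u := X

instance WithSigma.instMeasurableSpace {X : Type u} (C : MeasurableSpace X) :
    MeasurableSpace (WithSigma C) := C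

/-- The identity `X → X_C`. -/
def toSigma {X : Type u} (C : MeasurableSpace X) (a : X) : WithSigma C := a

/-- The identity `X_C → X`. -/
def ofSigma {X : Type u} {C : MeasurableSpace X} (a : WithSigma C) : X := a

theorem measurable_toSigma {X : Type u} {C : MeasurableSpace X} [m : MeasurableSpace X]
    (hC : C ≤ m) : Measurable (toSigma C) := fun A hA => hC A hA

/-- The sub-sigma-algebra `C` defines a subsystem of `P`, with `R` as the effectivity function on
`X_C`: the identity `X → X_C` is a morphism `P → R`. -/
structure IsSubsystemWith {X : Type u} (C : MeasurableSpace X) [m : MeasurableSpace X]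
    (P : EffFn X X) (R : EffFn (WithSigma C) (WithSigma C)) : Prop where
  le : C ≤ m
  morphism : IsMorphism P R (toSigma C) (toSigma C)

/-- An effectivity function from `X_C` to `T`, with the same portfolios, considered as one from
`X` (with its own, finer sigma-algebra) to `T`. -/
def EffFn.refine {X : Type u} {T : Type v} {C : MeasurableSpace X} [m : MeasurableSpace X]
    [MeasurableSpace T] (R : EffFn (WithSigma C) T) (hC : C ≤ m) : EffFn X T where
  portfolio a := R.portfolio (toSigma C a)
  measurableSet_of_mem a := R.measurableSet_of_mem (toSigma C a)
  upper_closed a := R.upper_closed (toSigma C a)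
  t_measurable H hH :=
    (((measurable_toSigma hC).comp measurable_fst).prodMk measurable_snd) (R.t_measurable H hH)

/-- The sigma-algebra `Σ_f` of all measurable sets that are invariant under the kernel of `f`. -/
@[reducible] def invariantSigma {S : Type u} {U : Type v} [MeasurableSpace S] (f : S → U) :
    MeasurableSpace S where
  MeasurableSet' A := MeasurableSet A ∧ ∀ a b, f a = f b → a ∈ A → b ∈ A
  measurableSet_empty := ⟨MeasurableSet.empty, fun _ _ _ h => h⟩
  measurableSet_compl A hA :=
    ⟨hA.1.compl, fun a b hab ha hb => ha (hA.2 b a hab.symm hb)⟩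
  measurableSet_iUnion A hA := by
    refine ⟨MeasurableSet.iUnion fun i => (hA i).1, fun a b hab ha => ?_⟩
    obtain ⟨i, hi⟩ := mem_iUnion.1 ha
    exact mem_iUnion.2 ⟨i, (hA i).2 a b hab hi⟩

theorem invariantSigma_le {S : Type u} {U : Type v} [m : MeasurableSpace S] (f : S → U) :
    invariantSigma f ≤ m := fun _ hA => hA.1

/-! ### The set `W` -/

/-- The set `W = {(s, t) | f s = g t}`; as a measurable space it carries the trace of the product
sigma-algebra of `S × T`. -/
abbrev Pullback {S : Type u} {T : Type v} {U : Type w} (f : S → U) (g : T → U) : Type (max u v) :=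
  {p : S × T // f p.1 = g p.2}

/-- The trace on `W` of the product sigma-algebra of `Σ_f` and `Σ_g`. -/
@[reducible] def pullbackSigma {S : Type u} {T : Type v} {U : Type w} [MeasurableSpace S] [MeasurableSpace T]
    (f : S → U) (g : T → U) : MeasurableSpace (Pullback f g) :=
  MeasurableSpace.comap Subtype.val ((invariantSigma f).prod (invariantSigma g))

theorem pullbackSigma_le {S : Type u} {T : Type v} {U : Type w}
    [MeasurableSpace S] [MeasurableSpace T] (f : S → U) (g : T → U) :
    pullbackSigma f g ≤ (inferInstance : MeasurableSpace (Pullback f g)) :=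
  MeasurableSpace.comap_mono (sup_le_sup
    (MeasurableSpace.comap_mono (invariantSigma_le f))
    (MeasurableSpace.comap_mono (invariantSigma_le g)))

/-- The projections of `W`, where `W` and its targets carry the full sigma-algebras. -/
def projS {S : Type u} {T : Type v} {U : Type w} (f : S → U) (g : T → U) :
    Pullback f g → S := fun p => p.1.1

def projT {S : Type u} {T : Type v} {U : Type w} (f : S → U) (g : T → U) :
    Pullback f g → T := fun p => p.1.2

/-- The projections of `W`, where `W` and its targets carry the small sigma-algebras. -/
def projSigmaS {S : Type u} {T : Type v} {U : Type w} [MeasurableSpace S] [MeasurableSpace T]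
    (f : S → U) (g : T → U) :
    WithSigma (pullbackSigma f g) → WithSigma (invariantSigma f) :=
  fun p => toSigma (invariantSigma f) (projS f g (ofSigma p))

def projSigmaT {S : Type u} {T : Type v} {U : Type w} [MeasurableSpace S] [MeasurableSpace T]
    (f : S → U) (g : T → U) :
    WithSigma (pullbackSigma f g) → WithSigma (invariantSigma g) :=
  fun p => toSigma (invariantSigma g) (projT f g (ofSigma p))

end Effectivity

namespace Effectivity

/-! ### Functoriality of the image -/

/-! By Blackwell–Mackey, a Borel set invariant under the kernel of the surjection `f` is the
preimage of a Borel set of `U`. Hence the σ-algebras on `S`, `T` and `W` are all induced by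
surjections onto `U`, namely `f`, `g` and the common composite `f ∘ π_S = g ∘ π_T`. If `h : X → U`
induces the σ-algebra of `X`, any set-theoretic section `s` of `h` is measurable, and measurable
sets cannot separate `x` from `s (h x)`. So `SubProb.map h` and `SubProb.map s` are mutually
inverse, and `M` transports to `X` (`EffFn.pull`). A measurable map over `U` into `X` then lifts a
morphism into `M` to one into the transported function (`IsMorphism.lift`). All the required
morphisms arise this way, up to refining the domains. -/

theorem SubProb.measurable_map {X Y : Type*} [MeasurableSpace X] [MeasurableSpace Y]
    {h : X → Y} (hh : Measurable h) : Measurable (SubProb.map h) :=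
  ((Measure.measurable_map h hh).comp measurable_subtype_coe).subtype_mk

theorem SubProb.map_map {X Y Z : Type*} [MeasurableSpace X] [MeasurableSpace Y]
    [MeasurableSpace Z] {k : Y → Z} {h : X → Y} (hk : Measurable k) (hh : Measurable h)
    (μ : SubProb X) : SubProb.map k (SubProb.map h μ) = SubProb.map (k ∘ h) μ :=
  Subtype.ext (Measure.map_map hk hh)

/-- Needed because `s ∘ h` is in general not the identity pointwise, yet acts as the identity on
measures. -/
theorem SubProb.map_congr_preimage {X Y : Type*} [MeasurableSpace X] [MeasurableSpace Y]
    {h k : X → Y} (hh : Measurable h) (hk : Measurable k)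
    (hhk : ∀ A, MeasurableSet A → h ⁻¹' A = k ⁻¹' A) : SubProb.map h = SubProb.map k := by
  funext μ
  refine Subtype.ext (Measure.ext fun A hA => ?_)
  change μ.1.map h A = μ.1.map k A
  rw [Measure.map_apply hh hA, Measure.map_apply hk hA, hhk A hA]

/-! ### Measurable quotient maps up to the sigma-algebra -/

/-- `s` is a measurable section of the measurable map `h`, and `h` generates the sigma-algebra
of its domain up to that section: measurable sets of `X` do not distinguish `x` from `s (h x)`. -/
structure IsMeasurableSection {X U : Type*} [MeasurableSpace X] [MeasurableSpace U]
    (h : X → U) (s : U → X) : Prop where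
  measurable : Measurable h
  measurable_section : Measurable s
  right_inverse : ∀ u, h (s u) = u
  preimage_eq : ∀ A, MeasurableSet A → (s ∘ h) ⁻¹' A = A

/-- A surjective map that induces the sigma-algebra of its domain has a measurable section. -/
theorem exists_isMeasurableSection {X U : Type*} [mX : MeasurableSpace X] [MeasurableSpace U]
    {h : X → U} (hs : Function.Surjective h)
    (hX : mX = MeasurableSpace.comap h inferInstance) : ∃ s, IsMeasurableSection h s := by
  have hr := Function.rightInverse_surjInv hs
  have hpre : ∀ A, MeasurableSet A → ∃ B, MeasurableSet B ∧ h ⁻¹' B = A := fun A hA => by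
    rwa [hX] at hA
  -- Any right inverse `s` will do: a measurable set has the form `h ⁻¹' B`, and its preimage under
  -- `s` is `B`.
  refine ⟨Function.surjInv hs, ?_, fun A hA => ?_, hr, fun A hA => ?_⟩
  · exact Measurable.of_comap_le hX.ge
  · obtain ⟨B, hB, rfl⟩ := hpre A hA
    rwa [← preimage_comp, hr.comp_eq_id, preimage_id]
  · obtain ⟨B, -, rfl⟩ := hpre A hA
    ext x
    simp [hr (h x)]

/-- The effectivity function on `X` obtained from one on `U` along a map with a measurable
section. -/
def EffFn.pull {X U : Type*} [MeasurableSpace X] [MeasurableSpace U] (M : EffFn U U)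
    {h : X → U} {s : U → X} (hs : IsMeasurableSection h s) : EffFn X X where
  portfolio x := {A | MeasurableSet A ∧ SubProb.map s ⁻¹' A ∈ M.portfolio (h x)}
  measurableSet_of_mem _ _ hA := hA.1
  upper_closed x _ hA B hB hAB := ⟨hB, M.upper_closed (h x) _ hA.2 _
    (SubProb.measurable_map hs.measurable_section hB) (preimage_mono hAB)⟩
  t_measurable H hH := by
    have hH' : MeasurableSet (Prod.map (SubProb.map s) id ⁻¹' H : Set (SubProb U × unitInterval)) :=
      ((SubProb.measurable_map hs.measurable_section).prodMap measurable_id) hH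
    convert ((hs.measurable.comp measurable_fst).prodMk measurable_snd)
      (M.t_measurable _ hH') using 1
    ext ⟨x, q⟩
    -- The measurability clause in the portfolio is automatic, since sections of `H` are measurable.
    exact and_iff_right (measurable_prodMk_right hH)

/-- A measurable lift `j` through `h` of a morphism into `M` is a morphism into `M.pull`. -/
theorem IsMorphism.lift {Y X U : Type*} [MeasurableSpace Y] [MeasurableSpace X]
    [MeasurableSpace U] {P : EffFn Y Y} {M : EffFn U U} {h : X → U} {s : U → X} {k : Y → U}
    (hs : IsMeasurableSection h s) (hk : IsMorphism P M k k) {j : Y → X} (hj : Measurable j)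
    (hjk : ∀ y, h (j y) = k y) : IsMorphism P (M.pull hs) j j where
  measurable_left := hj
  measurable_right := hj
  comm y := by
    -- The maps `s ∘ k = (s ∘ h) ∘ j` and `j` may differ pointwise, but no measurable set sees it.
    have hmap : SubProb.map s ∘ SubProb.map k = SubProb.map j := by
      funext μ
      rw [Function.comp_apply, SubProb.map_map hs.measurable_section hk.measurable_left]
      refine congrFun (SubProb.map_congr_preimage
        (hs.measurable_section.comp hk.measurable_left) hj fun A hA => ?_) μ
      rw [show s ∘ k = (s ∘ h) ∘ j from funext fun y => congrArg s (hjk y).symm,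
        preimage_comp, hs.preimage_eq A hA]
    ext G
    refine and_congr_right fun hG => ?_
    rw [hjk, hk.comm, mem_ofPred_eq, ← preimage_comp, hmap]
    exact and_iff_right (SubProb.measurable_map hs.measurable_section hG)

/-- Here `h ∘ s = id` holds pointwise, so pulling `G` back along `h` and then `s` returns `G`. -/
theorem EffFn.isMorphism_pull {X U : Type*} [MeasurableSpace X] [MeasurableSpace U]
    (M : EffFn U U) {h : X → U} {s : U → X} (hs : IsMeasurableSection h s) :
    IsMorphism (M.pull hs) M h h where
  measurable_left := hs.measurable
  measurable_right := hs.measurable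
  comm x := by
    have hmap : SubProb.map h ∘ SubProb.map s = id := by
      funext μ
      rw [Function.comp_apply, SubProb.map_map hs.measurable hs.measurable_section,
        show h ∘ s = id from funext hs.right_inverse]
      exact Subtype.ext Measure.map_id
    ext G
    change _ ↔ MeasurableSet G ∧ MeasurableSet _ ∧ _
    rw [← preimage_comp, hmap, preimage_id]
    exact ⟨fun hG => ⟨M.measurableSet_of_mem _ G hG,
      SubProb.measurable_map hs.measurable (M.measurableSet_of_mem _ G hG), hG⟩, fun hG => hG.2.2⟩

/-- Refinement changes only the σ-algebra of the domain, so the portfolio condition is untouched. -/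
theorem IsMorphism.refine {X Y : Type*} {C : MeasurableSpace X} {D : MeasurableSpace Y}
    [mX : MeasurableSpace X] [mY : MeasurableSpace Y]
    {R : EffFn (WithSigma C) (WithSigma C)} {R' : EffFn (WithSigma D) (WithSigma D)}
    (hC : C ≤ mX) (hD : D ≤ mY) {h : X → Y} {k : WithSigma C → WithSigma D}
    (hk : IsMorphism R R' k k) (hh : Measurable h)
    (hhk : ∀ x, toSigma D (h x) = k (toSigma C x)) :
    IsMorphism (R.refine hC) (R'.refine hD) h k where
  measurable_left := hh
  measurable_right := hk.measurable_right
  comm x := by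
    change R'.portfolio (toSigma D (h x)) = _
    rw [hhk, hk.comm]
    rfl

/-! ### The sigma-algebras of invariant sets -/

/-- The Blackwell–Mackey theorem for a surjective Borel map. -/
theorem invariantSigma_eq_comap {S U : Type*} [MeasurableSpace S] [StandardBorelSpace S]
    [MeasurableSpace U] [StandardBorelSpace U] {f : S → U} (hf : Measurable f)
    (hs : Function.Surjective f) :
    invariantSigma f = MeasurableSpace.comap f inferInstance := by
  ext A
  constructor
  · rintro ⟨hA, hinv⟩
    have hpre : f ⁻¹' (f '' A) = A := by
      refine Subset.antisymm ?_ (subset_preimage_image f A)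
      rintro b ⟨a, ha, hab⟩
      exact hinv a b hab ha
    -- The images of `A` and its complement are disjoint analytic sets covering `U`, so Lusin
    -- separation makes them Borel.
    exact ⟨f '' A, (hf.measurableSet_preimage_iff_of_surjective hs).1 (hpre.symm ▸ hA), hpre⟩
  · rintro ⟨B, hB, rfl⟩
    exact ⟨hf hB, fun a b hab ha => by rwa [mem_preimage, ← hab]⟩

/-- The two factors induce the same σ-algebra on `W`, because `f ∘ π_S = g ∘ π_T` there. -/
theorem pullbackSigma_eq_comap {S T U : Type*} [MeasurableSpace S] [StandardBorelSpace S]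
    [MeasurableSpace T] [StandardBorelSpace T] [MeasurableSpace U] [StandardBorelSpace U]
    {f : S → U} {g : T → U} (hf : Measurable f) (hg : Measurable g)
    (hfs : Function.Surjective f) (hgs : Function.Surjective g) :
    pullbackSigma f g = MeasurableSpace.comap (fun w => f (projS f g w)) inferInstance := by
  have hfg : (fun w : Pullback f g => f (projS f g w)) = fun w => g (projT f g w) :=
    funext fun w => w.2
  rw [pullbackSigma, invariantSigma_eq_comap hf hfs, invariantSigma_eq_comap hg hgs,
    MeasurableSpace.prod, MeasurableSpace.comap_sup, MeasurableSpace.comap_comp,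
    MeasurableSpace.comap_comp, MeasurableSpace.comap_comp, MeasurableSpace.comap_comp]
  change MeasurableSpace.comap (fun w => f (projS f g w)) _ ⊔
    MeasurableSpace.comap (fun w => g (projT f g w)) _ = _
  rw [← hfg, sup_idem]

theorem measurable_projSigmaS {S T U : Type*} [MeasurableSpace S] [MeasurableSpace T]
    (f : S → U) (g : T → U) : Measurable (projSigmaS f g) :=
  fun A hA => ⟨Prod.fst ⁻¹' A,
    (@measurable_fst S T (invariantSigma f) (invariantSigma g) A hA :), rfl⟩

theorem measurable_projSigmaT {S T U : Type*} [MeasurableSpace S] [MeasurableSpace T]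
    (f : S → U) (g : T → U) : Measurable (projSigmaT f g) :=
  fun A hA => ⟨Prod.snd ⁻¹' A,
    (@measurable_snd S T (invariantSigma f) (invariantSigma g) A hA :), rfl⟩

end Effectivity

open Effectivity in
theorem mainTheorem9 {S T U : Type*}
    [MeasurableSpace S] [StandardBorelSpace S]
    [MeasurableSpace T] [StandardBorelSpace T]
    [MeasurableSpace U] [StandardBorelSpace U]
    (P : EffFn S S) (Q : EffFn T T)
    (hP : P.FinitelySupported) (hQ : Q.FinitelySupported)
    (M : EffFn U U) (f : S → U) (g : T → U)
    (hM : MediatesBehavioralEquivalence P Q M f f g g) :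
    ∃ (PC : EffFn (WithSigma (invariantSigma f)) (WithSigma (invariantSigma f)))
      (QC : EffFn (WithSigma (invariantSigma g)) (WithSigma (invariantSigma g)))
      (τ : EffFn (WithSigma (pullbackSigma f g)) (WithSigma (pullbackSigma f g))),
      IsSubsystemWith (invariantSigma f) P PC ∧
      IsSubsystemWith (invariantSigma g) Q QC ∧
      MediatesBisimilarity PC QC τ
        (projSigmaS f g) (projSigmaS f g) (projSigmaT f g) (projSigmaT f g) ∧
      MediatesBisimilarity
        (PC.refine (invariantSigma_le f)) (QC.refine (invariantSigma_le g))
        (τ.refine (pullbackSigma_le f g))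
        (projS f g) (projSigmaS f g) (projT f g) (projSigmaT f g) := by
  have hf := hM.left.measurable_left
  have hg := hM.right.measurable_left
  have hfs := hM.left_surjective.1
  have hgs := hM.right_surjective.1
  obtain ⟨sS, hS⟩ := exists_isMeasurableSection
    (X := WithSigma (invariantSigma f)) (h := fun x => f (ofSigma x)) hfs
    (invariantSigma_eq_comap (f := f) hf hfs :)
  obtain ⟨sT, hT⟩ := exists_isMeasurableSection
    (X := WithSigma (invariantSigma g)) (h := fun x => g (ofSigma x)) hgs
    (invariantSigma_eq_comap (f := g) hg hgs :)
  have hWs : Function.Surjective fun w : Pullback f g => f (projS f g w) := fun u => by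
    obtain ⟨a, rfl⟩ := hfs u
    obtain ⟨b, hb⟩ := hgs (f a)
    exact ⟨⟨(a, b), hb.symm⟩, rfl⟩
  obtain ⟨sW, hW⟩ := exists_isMeasurableSection
    (X := WithSigma (pullbackSigma f g)) (h := fun w => f (projS f g (ofSigma w))) hWs
    (pullbackSigma_eq_comap hf hg hfs hgs)
  have hτ := M.isMorphism_pull hW
  have hτS := hτ.lift hS (measurable_projSigmaS f g) fun _ => rfl
  -- The same morphism into `M` lifts through `g` as well, by the defining equation of `W`.
  have hτT := hτ.lift hT (measurable_projSigmaT f g) fun w => w.2.symm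
  refine ⟨M.pull hS, M.pull hT, M.pull hW, ⟨invariantSigma_le f, ?_⟩, ⟨invariantSigma_le g, ?_⟩,
    ⟨hτS, hτT⟩, ⟨?_, ?_⟩⟩
  · exact hM.left.lift hS (measurable_toSigma (invariantSigma_le f)) fun _ => rfl
  · exact hM.right.lift hT (measurable_toSigma (invariantSigma_le g)) fun _ => rfl
  · exact hτS.refine _ _ (measurable_fst.comp measurable_subtype_coe) fun _ => rfl
  · exact hτT.refine _ _ (measurable_snd.comp measurable_subtype_coe) fun _ => rfl
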